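/- Theorem 5.5 (Quantum Hatano–Sasa inequality). Let $H$ be a finite-dimensional complex Hilbert space, let $N\ge 0$, and let $\mathcal E_1,\dots,\mathcal E_N$ be completely positive trace-preserving linear maps on the operators on $H$. A state is a positive operator of trace one. Assume that each $\mathcal E_n$ has a unique steady state $\rho_{\mathrm{ss},n}$, that is, $\rho_{\mathrm{ss},n}$ is the only state with $\mathcal E_n(\rho_{\mathrm{ss},n})=\rho_{\mathrm{ss},n}$. Let $\rho_0$ be a state, let $\rho_n:=\mathcal E_n(\rho_{n-1})$ for $1\le n\le N$, and let $\mathcal E:=\mathcal E_N\circ\cdots\circ\mathcal E_1$. Write $S(\rho):=-\mathrm{tr}[\rho\ln\rho]$ (with $0\ln 0=0$) and $\Delta S:=S(\mathcal E(\rho_0))-S(\rho_0)$. For states $\rho,\sigma$ the quantity $\mathrm{tr}[\rho\ln\sigma]\in[-\infty,0]$ is $-\infty$ if there is $\psi\in H$ with $\sigma\psi=0$ and $\langle\psi,\rho\psi\rangle\neq 0$; otherwise it is the usual finite trace, computed with any value of $\ln\sigma$ on $\ker\sigma$. Suppose that for no $n$ are both $\mathrm{tr}[\rho_n\ln\rho_{\mathrm{ss},n}]$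 and $\mathrm{tr}[\rho_{n-1}\ln\rho_{\mathrm{ss},n}]$ equal to $-\infty$ (this is automatic if all $\rho_{\mathrm{ss},n}$ are positive definite), so that every difference below is defined. Then, in the extended reals, $$\Delta S\ \ge\ -\sigma_{\mathrm{ex}}^B,\qquad \sigma_{\mathrm{ex}}^B:=\sum_{n=1}^N\bigl(\mathrm{tr}[\rho_n\ln\rho_{\mathrm{ss},n}]-\mathrm{tr}[\rho_{n-1}\ln\rho_{\mathrm{ss},n}]\bigr).$$ -/

import Mathlib

open scoped CStarAlgebra InnerProductSpace

namespace HatanoSasa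

noncomputable section

/-- The trace of an operator on a finite-dimensional Hilbert space. -/
def tr {H : Type*} [NormedAddCommGroup H] [InnerProductSpace ℂ H] (X : H →L[ℂ] H) : ℂ :=
  LinearMap.trace ℂ H (X : H →ₗ[ℂ] H)

/-- Density operators: positive operators of trace one. -/
def IsDensity {H : Type*} [NormedAddCommGroup H] [InnerProductSpace ℂ H]
    (ρ : H →L[ℂ] H) : Prop :=
  0 ≤ ρ ∧ tr ρ = 1

/-- A linear map on operators is trace preserving if `tr (E X) = tr X` for every operator `X`. -/
def IsTracePreserving {H : Type*} [NormedAddCommGroup H] [InnerProductSpace ℂ H]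
    (E : (H →L[ℂ] H) →ₗ[ℂ] (H →L[ℂ] H)) : Prop :=
  ∀ X, tr (E X) = tr X

/-- `σ` is the unique steady state of `E`: it is a density operator fixed by `E`, and every density
operator fixed by `E` equals it. -/
def IsUniqueSteadyState {H : Type*} [NormedAddCommGroup H] [InnerProductSpace ℂ H]
    (E : (H →L[ℂ] H) →ₗ[ℂ] (H →L[ℂ] H)) (σ : H →L[ℂ] H) : Prop :=
  IsDensity σ ∧ E σ = σ ∧ ∀ ρ, IsDensity ρ → E ρ = ρ → ρ = σ

/-- The composition `E N ∘ ⋯ ∘ E 2 ∘ E 1` (the identity for `N = 0`). -/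
def composedMap {H : Type*} [NormedAddCommGroup H] [InnerProductSpace ℂ H]
    (E : ℕ → ((H →L[ℂ] H) →ₗ[ℂ] (H →L[ℂ] H))) : ℕ → ((H →L[ℂ] H) →ₗ[ℂ] (H →L[ℂ] H))
  | 0 => LinearMap.id
  | n + 1 => E (n + 1) ∘ₗ composedMap E n

/-- The von Neumann entropy `S(ρ) = - tr [ρ ln ρ]`. The logarithm is taken in the functional
calculus; since `Real.log 0 = 0`, the convention `0 ln 0 = 0` is in force. -/
def vonNeumannEntropy {H : Type*} [NormedAddCommGroup H] [InnerProductSpace ℂ H] [CompleteSpace H]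
    (ρ : H →L[ℂ] H) : ℝ :=
  -(tr (ρ * CFC.log ρ)).re

open Classical in
/-- The quantity `tr [ρ ln σ]` for density operators `ρ` and `σ`, with values in `[-∞, 0]`.
It is `-∞` if `ρ` charges the kernel of `σ`, that is, if `σ ψ = 0` and `⟨ψ, ρ ψ⟩ ≠ 0` for some `ψ`
(equivalently, if the relative entropy of `ρ` to `σ` is `+∞`). Otherwise `ρ` vanishes on the kernel
of `σ`, and the trace does not depend on the value given to `ln σ` there. -/
def traceMulLog {H : Type*} [NormedAddCommGroup H] [InnerProductSpace ℂ H] [CompleteSpace H]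
    (ρ σ : H →L[ℂ] H) : EReal :=
  if ∃ ψ : H, σ ψ = 0 ∧ ⟪ψ, ρ ψ⟫_ℂ ≠ 0 then ⊥ else (((tr (ρ * CFC.log σ)).re : ℝ) : EReal)

/-- The quantity `∑ n = 1, …, N, (tr [ρ_n ln σ_n] - tr [ρ_(n-1) ln σ_n])`. -/
def excessEntropy {H : Type*} [NormedAddCommGroup H] [InnerProductSpace ℂ H] [CompleteSpace H]
    (N : ℕ) (ρ σ : ℕ → (H →L[ℂ] H)) : EReal :=
  ∑ n ∈ Finset.Icc 1 N, (traceMulLog (ρ n) (σ n) - traceMulLog (ρ (n - 1)) (σ n))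

end

end HatanoSasa

/-!
For states `ρ`, `σ` put `D(ρ ‖ σ) = -S(ρ) - tr [ρ ln σ]`. Since `E n` fixes `σ n`, the summand
`tr [ρ_n ln σ_n] - tr [ρ_(n-1) ln σ_n]` is at least `S(ρ_(n-1)) - S(ρ_n)` exactly when
`D(E ρ ‖ E σ) ≤ D(ρ ‖ σ)` for `ρ = ρ_(n-1)`, `σ = σ_n`, `E = E n`. So the theorem is the
data processing inequality for the relative entropy (`data_processing`), summed over `n`. If
`tr [ρ_(n-1) ln σ_n] = -∞`, the summand is `+∞`. If it is finite, then so is `tr [ρ_n ln σ_n]`,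
which is part of `data_processing`.

Data processing is proved through the quasi-entropies
`Q_t(ρ, σ) = ⟨ρ, (L_σ + t R_ρ)⁻¹ ρ⟩ = max_X (2 Re tr(ρ X) - tr(σ X X*) - t tr(ρ X* X))`, `t > 0`,
where `L_σ` and `R_ρ` are left and right multiplication and the inner product of operators is
`tr(X* Y)`. If `X = Φ(Y)` for the trace dual `Φ` of `E`, the Kadison–Schwarz inequality
(`re_tr_mul_mul_star_le`) says that the functional of the pair `(E ρ, E σ)` at `Y` is at most that
of `(ρ, σ)` at `X`; hence `Q_t(E ρ, E σ) ≤ Q_t(ρ, σ)` (`quasiEntropy_map_le`). In eigenbases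
`ρ e_i = p_i e_i`, `σ f_j = q_j f_j` one has
`Q_t = ∑ |⟨e_i, f_j⟩|² p_i² / (q_j + t p_i)`, the derivative of
`∑ |⟨e_i, f_j⟩|² p_i log (q_j + t p_i)`. Comparing the latter at `t = ε` and `t = 1/ε` and letting
`ε → 0` gives the relative entropies (`relative_entropy_le_of_quasiEntropy_le`). No invertibility is
needed: `D(ρ ‖ σ)` is finite iff `t Q_t → 0` as `t → 0`, which passes from `(ρ, σ)` to
`(E ρ, E σ)`.
-/

namespace HatanoSasa

/-! ### The trace and the trace pairing -/

section Trace

variable {H : Type*} [NormedAddCommGroup H] [InnerProductSpace ℂ H]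

lemma tr_add (X Y : H →L[ℂ] H) : tr (X + Y) = tr X + tr Y := by simp [tr]

lemma tr_sub (X Y : H →L[ℂ] H) : tr (X - Y) = tr X - tr Y := by simp [tr]

lemma tr_mul_comm (X Y : H →L[ℂ] H) : tr (X * Y) = tr (Y * X) :=
  LinearMap.trace_mul_comm ℂ (X : H →ₗ[ℂ] H) (Y : H →ₗ[ℂ] H)

lemma tr_eq_sum_inner {ι : Type*} [Fintype ι] (b : OrthonormalBasis ι ℂ H) (X : H →L[ℂ] H) :
    tr X = ∑ i, ⟪b i, X (b i)⟫_ℂ :=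
  LinearMap.trace_eq_sum_inner (X : H →ₗ[ℂ] H) b

variable [FiniteDimensional ℂ H] [CompleteSpace H]

lemma tr_star (X : H →L[ℂ] H) : tr (star X) = star (tr X) := by
  rw [tr_eq_sum_inner (stdOrthonormalBasis ℂ H), tr_eq_sum_inner (stdOrthonormalBasis ℂ H),
    star_sum]
  refine Finset.sum_congr rfl fun i _ => ?_
  rw [ContinuousLinearMap.star_eq_adjoint, ContinuousLinearMap.adjoint_inner_right]
  exact (inner_conj_symm _ _).symm

omit [FiniteDimensional ℂ H] in
lemma tr_star_mul_self {ι : Type*} [Fintype ι] (b : OrthonormalBasis ι ℂ H) (X : H →L[ℂ] H) :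
    tr (star X * X) = ((∑ i, ‖X (b i)‖ ^ 2 : ℝ) : ℂ) := by
  rw [tr_eq_sum_inner b]
  push_cast
  refine Finset.sum_congr rfl fun i _ => ?_
  change ⟪b i, ContinuousLinearMap.adjoint X (X (b i))⟫_ℂ = _
  rw [ContinuousLinearMap.adjoint_inner_right, inner_self_eq_norm_sq_to_K]
  rfl

lemma re_tr_star_mul_self_nonneg (X : H →L[ℂ] H) : 0 ≤ (tr (star X * X)).re := by
  rw [tr_star_mul_self (stdOrthonormalBasis ℂ H), Complex.ofReal_re]
  positivity

/-- The trace pairing `(A, X) ↦ tr (A X)` represents every linear functional. -/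
lemma exists_tr_mul_eq (l : (H →L[ℂ] H) →ₗ[ℂ] ℂ) : ∃ X : H →L[ℂ] H, ∀ A, l A = tr (A * X) := by
  let T : (H →L[ℂ] H) →ₗ[ℂ] Module.Dual ℂ (H →L[ℂ] H) :=
    LinearMap.mk₂ ℂ (fun X A => tr (A * X))
      (fun X Y A => by rw [mul_add, tr_add]) (fun c X A => by simp [tr])
      (fun X A B => by rw [add_mul, tr_add]) (fun c X A => by simp [tr])
  -- Testing `X` against `A = X*` shows that the pairing is nondegenerate.
  have hinj : Function.Injective T := by
    rw [injective_iff_map_eq_zero]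
    intro X hX
    have h0 : tr (star X * X) = 0 := LinearMap.congr_fun hX (star X)
    rw [tr_star_mul_self (stdOrthonormalBasis ℂ H), Complex.ofReal_eq_zero,
      Finset.sum_eq_zero_iff_of_nonneg (fun _ _ => by positivity)] at h0
    have : (X : H →ₗ[ℂ] H) = 0 :=
      (stdOrthonormalBasis ℂ H).toBasis.ext fun i => by simpa using h0 i (Finset.mem_univ i)
    ext v
    exact LinearMap.congr_fun this v
  have hsurj := (LinearMap.injective_iff_surjective_of_finrank_eq_finrank
    (Subspace.dual_finrank_eq (K := ℂ) (V := H →L[ℂ] H)).symm).1 hinj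
  obtain ⟨X, hX⟩ := hsurj l
  exact ⟨X, fun A => by rw [← hX]; rfl⟩

end Trace

/-! ### Eigenbases and the functional calculus -/

section Spectral

variable {H : Type*} [NormedAddCommGroup H] [InnerProductSpace ℂ H] [FiniteDimensional ℂ H]
  [CompleteSpace H]

omit [CompleteSpace H] in
lemma exists_eigenbasis {ρ : H →L[ℂ] H} (hρ : 0 ≤ ρ) :
    ∃ (e : OrthonormalBasis (Fin (Module.finrank ℂ H)) ℂ H) (p : Fin (Module.finrank ℂ H) → ℝ),
      (∀ i, 0 ≤ p i) ∧ ∀ i, ρ (e i) = (p i : ℂ) • e i := by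
  have hpos := (ContinuousLinearMap.nonneg_iff_isPositive ρ).1 hρ
  have hs : (ρ : H →ₗ[ℂ] H).IsSymmetric := hpos.isSymmetric
  refine ⟨hs.eigenvectorBasis rfl, hs.eigenvalues rfl, fun i => ?_, fun i =>
    hs.apply_eigenvectorBasis rfl i⟩
  exact LinearMap.IsPositive.nonneg_eigenvalues hpos.toLinearMap rfl i

omit [CompleteSpace H] in
lemma finite_spectrum_real (a : H →L[ℂ] H) : (spectrum ℝ a).Finite := by
  have h : (spectrum ℂ a).Finite := by
    rw [← AlgEquiv.spectrum_eq (Module.End.toContinuousLinearMap (𝕜 := ℂ) H).symm a]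
    exact Module.End.finite_spectrum _
  rw [← spectrum.preimage_algebraMap ℂ]
  exact h.preimage (algebraMap ℝ ℂ).injective.injOn

/-- The spectrum is finite, so the function may be replaced by a polynomial that interpolates it on
the spectrum and at `r`. -/
lemma cfc_apply_eigenvector {a : H →L[ℂ] H} (ha : IsSelfAdjoint a) (f : ℝ → ℝ) {r : ℝ} {v : H}
    (hv : a v = (r : ℂ) • v) : cfc f a v = (f r : ℂ) • v := by
  classical
  let s : Finset ℝ := insert r (finite_spectrum_real a).toFinset
  let P := Lagrange.interpolate s id f
  have hP : ∀ x ∈ s, P.eval x = f x := fun x hx =>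
    Lagrange.eval_interpolate_at_node f (Set.injOn_id _) hx
  have h1 : cfc f a = Polynomial.aeval a P := by
    rw [← cfc_polynomial P a ha]
    refine cfc_congr fun x hx => (hP x ?_).symm
    simp [s, hx]
  have h2 : ∀ Q : Polynomial ℝ, Polynomial.aeval a Q v = ((Q.eval r : ℝ) : ℂ) • v := by
    intro Q
    induction Q using Polynomial.induction_on' with
    | add p q hp hq => simp [hp, hq, add_smul]
    | monomial n c =>
      have : ∀ n : ℕ, (a ^ n) v = ((r : ℂ) ^ n) • v := by
        intro n
        induction n with
        | zero => simp
        | succ n ih => rw [pow_succ, mul_apply_eq_comp, hv, map_smul, ih, smul_smul,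
            pow_succ, mul_comm]
      rw [Polynomial.aeval_monomial, mul_apply_eq_comp, this,
        Polynomial.eval_monomial, Algebra.algebraMap_eq_smul_one]
      simp [smul_smul, ← Complex.coe_smul, mul_comm]
  rw [h1, h2, hP r (by simp [s])]

lemma inner_cfc_eigenvector {a : H →L[ℂ] H} (ha : IsSelfAdjoint a) (f : ℝ → ℝ) {r : ℝ} {v : H}
    (hv : a v = (r : ℂ) • v) (w : H) : ⟪v, cfc f a w⟫_ℂ = (f r : ℂ) * ⟪v, w⟫_ℂ := by
  have h : IsSelfAdjoint (cfc f a) := cfc_predicate f a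
  rw [← ContinuousLinearMap.adjoint_inner_left, ← ContinuousLinearMap.star_eq_adjoint, h.star_eq,
    cfc_apply_eigenvector ha f hv, inner_smul_left]
  simp

end Spectral

/-! ### The Kadison–Schwarz inequality for the trace dual -/

section Schwarz

lemma exists_eq_star_mul_self {A : Type*} [CStarAlgebra A] [PartialOrder A] [StarOrderedRing A]
    {a : A} (ha : 0 ≤ a) : ∃ b, a = star b * b :=
  CStarAlgebra.nonneg_iff_eq_star_mul_self.1 ha

variable {H : Type*} [NormedAddCommGroup H] [InnerProductSpace ℂ H]
    [FiniteDimensional ℂ H] [CompleteSpace H]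

omit [FiniteDimensional ℂ H] in
/-- The image of the positive block operator `[[s* s, s* w], [w* s, w* w]]` under a completely
positive map is again a positive block operator, hence a Gram matrix with entries
`a* a + c* c`, `a* b + c* d`, and so on. -/
lemma exists_gram_of_completelyPositive (E : (H →L[ℂ] H) →CP (H →L[ℂ] H)) (s w : H →L[ℂ] H) :
    ∃ a b c d : H →L[ℂ] H, E (star s * s) = star a * a + star c * c ∧
      E (star s * w) = star a * b + star c * d ∧ E (star w * s) = star b * a + star d * c ∧
      E (star w * w) = star b * b + star d * d := by
  let B : CStarMatrix (Fin 2) (Fin 2) (H →L[ℂ] H) := CStarMatrix.ofMatrix !![s, w; 0, 0]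
  have hM : 0 ≤ star B * B := star_mul_self_nonneg B
  have hEM := E.map_cstarMatrix_nonneg _ hM
  obtain ⟨C, hC⟩ := exists_eq_star_mul_self hEM
  have key : ∀ i j, E (∑ k, star (B k i) * B k j) = ∑ k, star (C k i) * C k j := fun i j =>
    congrFun (congrFun hC i) j
  simp only [Fin.sum_univ_two] at key
  have h00 := key 0 0
  have h01 := key 0 1
  have h10 := key 1 0
  have h11 := key 1 1
  simp [B] at h00 h01 h10 h11
  exact ⟨C 0 0, C 0 1, C 1 0, C 1 1, h00, h01, h10, h11⟩

omit [FiniteDimensional ℂ H] in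
lemma completelyPositive_map_star (E : (H →L[ℂ] H) →CP (H →L[ℂ] H)) (A : H →L[ℂ] H) :
    E (star A) = star (E A) := by
  obtain ⟨a, b, c, d, -, h01, h10, -⟩ := exists_gram_of_completelyPositive E 1 A
  simp only [star_one, one_mul, mul_one] at h01 h10
  rw [h01, h10]
  simp

/-- If `X` is the image of `Y` under the trace dual of a completely positive map, then `X*` is the
image of `Y*`. -/
lemma tr_dual_star {E : (H →L[ℂ] H) →CP (H →L[ℂ] H)} {X Y : H →L[ℂ] H}
    (hX : ∀ A, tr (E A * Y) = tr (A * X)) (A : H →L[ℂ] H) :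
    tr (E A * star Y) = tr (A * star X) := by
  have h := congrArg star (hX (star A))
  rw [← tr_star, ← tr_star, star_mul, star_mul, completelyPositive_map_star, star_star,
    star_star] at h
  rw [tr_mul_comm, h, tr_mul_comm]

/-- The Kadison–Schwarz inequality `Φ(Y) Φ(Y)* ≤ Φ(Y Y*)` for the trace dual `Φ` of a completely
positive trace preserving map, paired with a positive operator `σ`. -/
lemma re_tr_mul_mul_star_le {E : (H →L[ℂ] H) →CP (H →L[ℂ] H)}
    (hE : IsTracePreserving E.toLinearMap) {X Y : H →L[ℂ] H}
    (hX : ∀ A, tr (E A * Y) = tr (A * X)) {σ : H →L[ℂ] H} (hσ : 0 ≤ σ) :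
    (tr (σ * (X * star X))).re ≤ (tr (E σ * (Y * star Y))).re := by
  obtain ⟨s, rfl⟩ := exists_eq_star_mul_self hσ
  -- With `w = s X`, the images of the entries `w* s`, `s* w` and `w* w`, multiplied by `Y`, `Y*`
  -- and `1` respectively, all have trace `tr(σ X X*)`.
  obtain ⟨a, b, c, d, h00, h01, h10, h11⟩ := exists_gram_of_completelyPositive E s (s * X)
  -- Conjugating the image of the block operator by the column `(Y, -1)` gives a positive operator.
  have key : tr (E (star s * s) * (Y * star Y)) - tr (E (star (s * X) * s) * Y)
      - tr (E (star s * (s * X)) * star Y) + tr (E (star (s * X) * (s * X))) =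
      tr (star (a * Y - b) * (a * Y - b)) + tr (star (c * Y - d) * (c * Y - d)) := by
    rw [h00, h01, h10, h11, ← mul_assoc, tr_mul_comm _ (star Y), tr_mul_comm _ (star Y)]
    simp only [← tr_add, ← tr_sub]
    congr 1
    simp only [star_sub, star_mul]
    noncomm_ring
  have e1 : tr (E (star (s * X) * s) * Y) = tr (star s * s * (X * star X)) := by
    rw [hX, star_mul, mul_assoc, mul_assoc, tr_mul_comm]
    simp only [mul_assoc]
  have e2 : tr (E (star s * (s * X)) * star Y) = tr (star s * s * (X * star X)) := by
    rw [tr_dual_star hX]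
    simp only [mul_assoc]
  have e3 : tr (E (star (s * X) * (s * X))) = tr (star s * s * (X * star X)) := by
    have := hE (star (s * X) * (s * X))
    rw [show tr (E (star (s * X) * (s * X))) = _ from this, star_mul, mul_assoc, tr_mul_comm]
    simp only [mul_assoc]
  rw [e1, e2, e3] at key
  have hre := congrArg Complex.re key
  simp only [Complex.add_re, Complex.sub_re] at hre
  have := re_tr_star_mul_self_nonneg (a * Y - b)
  have := re_tr_star_mul_self_nonneg (c * Y - d)
  linarith

end Schwarz

/-! ### Quasi-entropies and their monotonicity -/

section QuasiEntropy

variable {H : Type*} [NormedAddCommGroup H] [InnerProductSpace ℂ H]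
    [FiniteDimensional ℂ H] [CompleteSpace H]

/-- The concave quadratic functional `X ↦ 2 Re tr(ρ X) - tr(σ X X*) - t tr(ρ X* X)`. Its maximum
is the quasi-entropy `⟨ρ, (L_σ + t R_ρ)⁻¹ ρ⟩`, where `L_σ` and `R_ρ` are left and right
multiplication and the inverse is taken on the orthogonal complement of the kernel. -/
noncomputable def quadFunctional (t : ℝ) (ρ σ X : H →L[ℂ] H) : ℝ :=
  2 * (tr (ρ * X)).re - (tr (σ * (X * star X))).re - t * (tr (ρ * (star X * X))).re

/-- The maximisation over `X` turns this comparison into monotonicity of the maximum. -/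
lemma quadFunctional_map_le {E : (H →L[ℂ] H) →CP (H →L[ℂ] H)}
    (hE : IsTracePreserving E.toLinearMap) {ρ σ : H →L[ℂ] H} (hρ : 0 ≤ ρ) (hσ : 0 ≤ σ)
    {t : ℝ} (ht : 0 ≤ t) {X Y : H →L[ℂ] H} (hX : ∀ A, tr (E A * Y) = tr (A * X)) :
    quadFunctional t (E ρ) (E σ) Y ≤ quadFunctional t ρ σ X := by
  have h1 := re_tr_mul_mul_star_le hE hX hσ
  have h2 := re_tr_mul_mul_star_le hE (tr_dual_star hX) hρ
  rw [star_star, star_star] at h2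
  have h3 := mul_le_mul_of_nonneg_left h2 ht
  unfold quadFunctional
  rw [hX ρ]
  linarith

variable {ι : Type*} [Fintype ι]

/-- The squared overlaps `|⟨e i, f j⟩|²` of two orthonormal bases. -/
noncomputable def overlap (e f : OrthonormalBasis ι ℂ H) (i j : ι) : ℝ := ‖⟪e i, f j⟫_ℂ‖ ^ 2

/-- The value of the quasi-entropy `⟨ρ, (L_σ + t R_ρ)⁻¹ ρ⟩` in terms of the eigenvalues `p` of `ρ`,
the eigenvalues `q` of `σ` and the overlaps `c` of the eigenbases. A summand with
`p i = q j = 0` is zero. -/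
noncomputable def quasiEntropy (t : ℝ) (p q : ι → ℝ) (c : ι → ι → ℝ) : ℝ :=
  ∑ i, ∑ j, c i j * (p i ^ 2 / (q j + t * p i))

omit [FiniteDimensional ℂ H] in
lemma inner_apply_eigenvector {ρ : H →L[ℂ] H} (hρ : IsSelfAdjoint ρ) {v : H} {r : ℝ}
    (hv : ρ v = (r : ℂ) • v) (w : H) : ⟪v, ρ w⟫_ℂ = (r : ℂ) * ⟪v, w⟫_ℂ := by
  rw [← ContinuousLinearMap.adjoint_inner_left, ← ContinuousLinearMap.star_eq_adjoint, hρ.star_eq,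
    hv, inner_smul_left]
  simp

omit [FiniteDimensional ℂ H] in
lemma quadFunctional_eq_sum (t : ℝ) {ρ σ : H →L[ℂ] H} (hρ : IsSelfAdjoint ρ)
    (hσ : IsSelfAdjoint σ)
    {e f : OrthonormalBasis ι ℂ H} {p q : ι → ℝ} (he : ∀ i, ρ (e i) = (p i : ℂ) • e i)
    (hf : ∀ j, σ (f j) = (q j : ℂ) • f j) (X : H →L[ℂ] H) :
    quadFunctional t ρ σ X = ∑ i, ∑ j, (2 * p i * (⟪e i, f j⟫_ℂ * ⟪f j, X (e i)⟫_ℂ).re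
      - (q j + t * p i) * ‖⟪f j, X (e i)⟫_ℂ‖ ^ 2) := by
  have h1 : (tr (ρ * X)).re = ∑ i, ∑ j, p i * (⟪e i, f j⟫_ℂ * ⟪f j, X (e i)⟫_ℂ).re := by
    rw [tr_eq_sum_inner e, Complex.re_sum]
    refine Finset.sum_congr rfl fun i _ => ?_
    rw [← Finset.mul_sum, ← Complex.re_sum, f.sum_inner_mul_inner, ← Complex.re_ofReal_mul,
      ← inner_apply_eigenvector hρ (he i)]
    rfl
  have h2 : (tr (σ * (X * star X))).re = ∑ i, ∑ j, q j * ‖⟪f j, X (e i)⟫_ℂ‖ ^ 2 := by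
    rw [tr_eq_sum_inner f, Complex.re_sum, Finset.sum_comm]
    refine Finset.sum_congr rfl fun j _ => ?_
    have : ⟪f j, (σ * (X * star X)) (f j)⟫_ℂ = q j * ⟪star X (f j), star X (f j)⟫_ℂ := by
      rw [ContinuousLinearMap.star_eq_adjoint, ContinuousLinearMap.adjoint_inner_left]
      exact inner_apply_eigenvector hσ (hf j) _
    rw [this, Complex.re_ofReal_mul, ← Finset.mul_sum]
    congr 1
    rw [inner_self_eq_norm_sq_to_K]
    norm_cast
    rw [← e.sum_sq_norm_inner_right]
    refine Finset.sum_congr rfl fun i _ => ?_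
    rw [ContinuousLinearMap.star_eq_adjoint, ContinuousLinearMap.adjoint_inner_right,
      norm_inner_symm]
  have h3 : (tr (ρ * (star X * X))).re = ∑ i, ∑ j, p i * ‖⟪f j, X (e i)⟫_ℂ‖ ^ 2 := by
    rw [tr_eq_sum_inner e, Complex.re_sum]
    refine Finset.sum_congr rfl fun i _ => ?_
    have : ⟪e i, (ρ * (star X * X)) (e i)⟫_ℂ = p i * ⟪X (e i), X (e i)⟫_ℂ := by
      rw [← ContinuousLinearMap.adjoint_inner_right]
      exact inner_apply_eigenvector hρ (he i) _
    rw [this, Complex.re_ofReal_mul, ← Finset.mul_sum]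
    congr 1
    rw [inner_self_eq_norm_sq_to_K, f.sum_sq_norm_inner_right]
    norm_cast
  rw [quadFunctional, h1, h2, h3]
  simp only [Finset.mul_sum, ← Finset.sum_sub_distrib]
  refine Finset.sum_congr rfl fun i _ => Finset.sum_congr rfl fun j _ => ?_
  ring

omit [FiniteDimensional ℂ H] in
/-- Each matrix entry `x = ⟨f j, X (e i)⟩` contributes at most the maximum
`|⟨e i, f j⟩|² p² / (q + t p)` of a concave quadratic in `x`. -/
lemma quadFunctional_le_quasiEntropy {t : ℝ} (ht : 0 < t) {ρ σ : H →L[ℂ] H}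
    (hρ : IsSelfAdjoint ρ) (hσ : IsSelfAdjoint σ)
    {e f : OrthonormalBasis ι ℂ H} {p q : ι → ℝ} (he : ∀ i, ρ (e i) = (p i : ℂ) • e i)
    (hf : ∀ j, σ (f j) = (q j : ℂ) • f j) (hp : ∀ i, 0 ≤ p i) (hq : ∀ j, 0 ≤ q j)
    (X : H →L[ℂ] H) :
    quadFunctional t ρ σ X ≤ quasiEntropy t p q (overlap e f) := by
  rw [quadFunctional_eq_sum t hρ hσ he hf, quasiEntropy]
  refine Finset.sum_le_sum fun i _ => Finset.sum_le_sum fun j _ => ?_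
  have hre : (⟪e i, f j⟫_ℂ * ⟪f j, X (e i)⟫_ℂ).re ≤ ‖⟪e i, f j⟫_ℂ‖ * ‖⟪f j, X (e i)⟫_ℂ‖ := by
    rw [← norm_mul]
    exact Complex.re_le_norm _
  unfold overlap
  set u := ‖⟪e i, f j⟫_ℂ‖
  set x := ‖⟪f j, X (e i)⟫_ℂ‖
  rcases (hp i).eq_or_lt with h0 | h0
  · rw [← h0]
    have := mul_nonneg (hq j) (sq_nonneg x)
    simpa using this
  · have hd : 0 < q j + t * p i := add_pos_of_nonneg_of_pos (hq j) (mul_pos ht h0)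
    calc _ ≤ 2 * p i * (u * x) - (q j + t * p i) * x ^ 2 := by gcongr
      _ ≤ u ^ 2 * (p i ^ 2 / (q j + t * p i)) := by
        rw [mul_div_assoc', le_div_iff₀ hd]
        nlinarith [sq_nonneg (p i * u - (q j + t * p i) * x)]

lemma exists_quadFunctional_eq_quasiEntropy {t : ℝ} (ht : 0 < t) {ρ σ : H →L[ℂ] H}
    (hρ : IsSelfAdjoint ρ) (hσ : IsSelfAdjoint σ)
    {e f : OrthonormalBasis ι ℂ H} {p q : ι → ℝ} (he : ∀ i, ρ (e i) = (p i : ℂ) • e i)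
    (hf : ∀ j, σ (f j) = (q j : ℂ) • f j) (hp : ∀ i, 0 ≤ p i) (hq : ∀ j, 0 ≤ q j) :
    ∃ X, quadFunctional t ρ σ X = quasiEntropy t p q (overlap e f) := by
  -- The maximiser has the matrix entries `⟨f j, X (e i)⟩ = p i / (q j + t p i) ⟨f j, e i⟩`, with
  -- `0 / 0 = 0` where `p i = q j = 0`.
  let X : H →L[ℂ] H := LinearMap.toContinuousLinearMap (e.toBasis.constr ℂ fun i =>
    ∑ j, (((p i / (q j + t * p i) : ℝ) : ℂ) * ⟪f j, e i⟫_ℂ) • f j)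
  have hX : ∀ i j, ⟪f j, X (e i)⟫_ℂ = ((p i / (q j + t * p i) : ℝ) : ℂ) * ⟪f j, e i⟫_ℂ := by
    intro i j
    have : X (e i) = ∑ j, (((p i / (q j + t * p i) : ℝ) : ℂ) * ⟪f j, e i⟫_ℂ) • f j := by
      have := e.toBasis.constr_basis ℂ (fun i =>
        ∑ j, (((p i / (q j + t * p i) : ℝ) : ℂ) * ⟪f j, e i⟫_ℂ) • f j) i
      rwa [OrthonormalBasis.coe_toBasis] at this
    rw [this]
    exact f.orthonormal.inner_right_fintype _ j
  refine ⟨X, ?_⟩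
  rw [quadFunctional_eq_sum t hρ hσ he hf, quasiEntropy]
  refine Finset.sum_congr rfl fun i _ => Finset.sum_congr rfl fun j _ => ?_
  have hre : (⟪e i, f j⟫_ℂ * ⟪f j, X (e i)⟫_ℂ).re =
      p i / (q j + t * p i) * ‖⟪e i, f j⟫_ℂ‖ ^ 2 := by
    rw [hX, mul_left_comm, Complex.re_ofReal_mul, ← inner_conj_symm (f j) (e i), RCLike.mul_conj]
    norm_cast
  rw [hre, hX, norm_mul, mul_pow, Complex.norm_real, Real.norm_eq_abs, sq_abs,
    norm_inner_symm (f j), overlap]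
  rcases (hp i).eq_or_lt with h0 | h0
  · simp [← h0]
  · have hd : 0 < q j + t * p i := add_pos_of_nonneg_of_pos (hq j) (mul_pos ht h0)
    field_simp
    ring

/-- Monotonicity of the quasi-entropies under completely positive trace preserving maps. -/
lemma quasiEntropy_map_le {E : (H →L[ℂ] H) →CP (H →L[ℂ] H)}
    (hE : IsTracePreserving E.toLinearMap) {ρ σ : H →L[ℂ] H} (hρ : 0 ≤ ρ) (hσ : 0 ≤ σ)
    {e f e' f' : OrthonormalBasis ι ℂ H} {p q p' q' : ι → ℝ}
    (he : ∀ i, ρ (e i) = (p i : ℂ) • e i) (hf : ∀ j, σ (f j) = (q j : ℂ) • f j)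
    (he' : ∀ i, E ρ (e' i) = (p' i : ℂ) • e' i) (hf' : ∀ j, E σ (f' j) = (q' j : ℂ) • f' j)
    (hp : ∀ i, 0 ≤ p i) (hq : ∀ j, 0 ≤ q j) (hp' : ∀ i, 0 ≤ p' i) (hq' : ∀ j, 0 ≤ q' j)
    {t : ℝ} (ht : 0 < t) :
    quasiEntropy t p' q' (overlap e' f') ≤ quasiEntropy t p q (overlap e f) := by
  obtain ⟨Y, hY⟩ := exists_quadFunctional_eq_quasiEntropy ht
    (IsSelfAdjoint.of_nonneg (map_nonneg E hρ)) (IsSelfAdjoint.of_nonneg (map_nonneg E hσ))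
    he' hf' hp' hq'
  obtain ⟨X, hX⟩ := exists_tr_mul_eq
    ((LinearMap.trace ℂ H ∘ₗ ContinuousLinearMap.coeLM ℂ) ∘ₗ
      LinearMap.mulRight ℂ Y ∘ₗ E.toLinearMap)
  rw [← hY]
  exact (quadFunctional_map_le hE hρ hσ ht.le hX).trans
    (quadFunctional_le_quasiEntropy ht (IsSelfAdjoint.of_nonneg hρ) (IsSelfAdjoint.of_nonneg hσ)
      he hf hp hq X)

end QuasiEntropy

/-! ### From quasi-entropies to relative entropies of eigenvalues -/

section Scalar

open Filter Topology

variable {ι : Type*} [Fintype ι] {p q p' q' : ι → ℝ} {c c' : ι → ι → ℝ}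

lemma hasDerivAt_sum_mul_log (hp : ∀ i, 0 ≤ p i) (hq : ∀ j, 0 ≤ q j) {t : ℝ} (ht : 0 < t) :
    HasDerivAt (fun s => ∑ i, ∑ j, c i j * p i * Real.log (q j + s * p i))
      (quasiEntropy t p q c) t := by
  refine HasDerivAt.fun_sum fun i _ => HasDerivAt.fun_sum fun j _ => ?_
  rcases (hp i).eq_or_lt with h0 | h0
  · simpa [← h0] using hasDerivAt_const t (0 : ℝ)
  · have hd : 0 < q j + t * p i := add_pos_of_nonneg_of_pos (hq j) (mul_pos ht h0)
    have h := (((((hasDerivAt_id t).mul_const (p i)).const_add (q j)).log hd.ne').const_mul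
      (c i j * p i))
    refine h.congr_deriv ?_
    rw [id_eq]
    ring

/-- The integral of the quasi-entropy from `ε` to `1/ε`, with its divergent part `-log ε` split off.
That part depends on the state only through its trace, so it cancels in comparisons. -/
lemma sum_mul_log_inv_sub (hp : ∀ i, 0 ≤ p i) (hq : ∀ j, 0 ≤ q j)
    (hsum : ∑ i, ∑ j, c i j * p i = 1) {ε : ℝ} (hε : 0 < ε) :
    ∑ i, ∑ j, c i j * p i * Real.log (q j + ε⁻¹ * p i)
        - ∑ i, ∑ j, c i j * p i * Real.log (q j + ε * p i) =
      ∑ i, ∑ j, c i j * p i * (Real.log (ε * q j + p i) - Real.log (q j + ε * p i))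
        - Real.log ε := by
  have h : Real.log ε = ∑ i, ∑ j, c i j * p i * Real.log ε := by
    simp_rw [← Finset.sum_mul _ _ (Real.log ε)]
    rw [hsum, one_mul]
  rw [h]
  simp only [← Finset.sum_sub_distrib]
  refine Finset.sum_congr rfl fun i _ => Finset.sum_congr rfl fun j _ => ?_
  rcases (hp i).eq_or_lt with h0 | h0
  · simp [← h0]
  · have hd : 0 < ε * q j + p i := add_pos_of_nonneg_of_pos (mul_nonneg hε.le (hq j)) h0
    rw [show q j + ε⁻¹ * p i = (ε * q j + p i) / ε by field_simp,
      Real.log_div hd.ne' hε.ne']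
    ring

lemma regularized_relative_entropy_le (hp : ∀ i, 0 ≤ p i) (hq : ∀ j, 0 ≤ q j)
    (hp' : ∀ i, 0 ≤ p' i) (hq' : ∀ j, 0 ≤ q' j)
    (hsum : ∑ i, ∑ j, c i j * p i = 1) (hsum' : ∑ i, ∑ j, c' i j * p' i = 1)
    (hle : ∀ t, 0 < t → quasiEntropy t p' q' c' ≤ quasiEntropy t p q c)
    {ε : ℝ} (hε : 0 < ε) (hε1 : ε < 1) :
    ∑ i, ∑ j, c' i j * p' i * (Real.log (ε * q' j + p' i) - Real.log (q' j + ε * p' i)) ≤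
      ∑ i, ∑ j, c i j * p i * (Real.log (ε * q j + p i) - Real.log (q j + ε * p i)) := by
  have hd : ∀ t ∈ Set.Ioi (0 : ℝ), HasDerivAt
      (fun s => ∑ i, ∑ j, c i j * p i * Real.log (q j + s * p i) -
        ∑ i, ∑ j, c' i j * p' i * Real.log (q' j + s * p' i))
      (quasiEntropy t p q c - quasiEntropy t p' q' c') t := fun t ht =>
    (hasDerivAt_sum_mul_log hp hq ht).sub (hasDerivAt_sum_mul_log hp' hq' ht)
  have hmono := monotoneOn_of_deriv_nonneg (convex_Ioi (0 : ℝ))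
    (fun t ht => (hd t ht).continuousAt.continuousWithinAt)
    (fun t ht => (hd t (interior_subset ht)).differentiableAt.differentiableWithinAt)
    (fun t ht => by
      rw [(hd t (interior_subset ht)).deriv]
      exact sub_nonneg.2 (hle t (interior_subset ht)))
  have h := hmono (a := ε) (b := ε⁻¹) hε (inv_pos.2 hε) (hε1.le.trans (one_le_inv₀ hε |>.2 hε1.le))
  have h1 := sum_mul_log_inv_sub hp hq hsum hε
  have h2 := sum_mul_log_inv_sub hp' hq' hsum' hε
  simp only at h
  linarith

/-- The support condition: `ρ` vanishes on the kernel of `σ`, in terms of the eigenvalues and the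
overlaps of the eigenbases. -/
def SupportLE (p q : ι → ℝ) (c : ι → ι → ℝ) : Prop := ∀ i j, q j = 0 → c i j * p i = 0

/-- A pair of indices violating the support condition makes `t * quasiEntropy t` bounded below by a
positive constant as `t → 0`, whereas it tends to `0` under the support condition. -/
lemma SupportLE.of_quasiEntropy_le (hp' : ∀ i, 0 ≤ p' i) (hq' : ∀ j, 0 ≤ q' j)
    (hc' : ∀ i j, 0 ≤ c' i j) (hs : SupportLE p q c)
    (hle : ∀ t, 0 < t → quasiEntropy t p' q' c' ≤ quasiEntropy t p q c) :
    SupportLE p' q' c' := by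
  intro i j hj
  by_contra hne
  have hpi : 0 < p' i := (hp' i).lt_of_ne fun h => hne (by simp [← h])
  have hlim : Tendsto (fun t => t * quasiEntropy t p q c) (𝓝[>] 0) (𝓝 0) := by
    have : Tendsto (fun t : ℝ => ∑ i, ∑ j, t * (c i j * (p i ^ 2 / (q j + t * p i)))) (𝓝 0)
        (𝓝 (∑ _i : ι, ∑ _j : ι, 0)) := by
      refine tendsto_finsetSum _ fun i _ => tendsto_finsetSum _ fun j _ => ?_
      by_cases hcp : c i j * p i = 0
      · rcases mul_eq_zero.1 hcp with h | h <;> simp [h]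
      · have hqj : q j ≠ 0 := fun h => hcp (hs i j h)
        have hcont : ContinuousAt (fun t : ℝ => t * (c i j * (p i ^ 2 / (q j + t * p i)))) 0 := by
          refine continuousAt_id.mul (continuousAt_const.mul (continuousAt_const.div
            (by fun_prop) (by simpa using hqj)))
        simpa using hcont.tendsto
    simp only [Finset.sum_const_zero] at this
    refine (this.mono_left nhdsWithin_le_nhds).congr fun t => ?_
    simp only [quasiEntropy, Finset.mul_sum]
  have hbound : ∀ᶠ t in 𝓝[>] (0 : ℝ), c' i j * p' i ≤ t * quasiEntropy t p q c := by
    filter_upwards [self_mem_nhdsWithin] with t ht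
    have ht : 0 < t := ht
    have hterm : ∀ k l, 0 ≤ c' k l * (p' k ^ 2 / (q' l + t * p' k)) := fun k l =>
      mul_nonneg (hc' k l) (div_nonneg (sq_nonneg _)
        (add_nonneg (hq' l) (mul_nonneg ht.le (hp' k))))
    have h1 : c' i j * (p' i ^ 2 / (q' j + t * p' i)) ≤ quasiEntropy t p' q' c' :=
      (Finset.single_le_sum (fun l _ => hterm i l) (Finset.mem_univ j)).trans
        (Finset.single_le_sum (f := fun k => ∑ l, c' k l * (p' k ^ 2 / (q' l + t * p' k)))
          (fun k _ => Finset.sum_nonneg fun l _ => hterm k l) (Finset.mem_univ i))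
    calc c' i j * p' i = t * (c' i j * (p' i ^ 2 / (q' j + t * p' i))) := by
          rw [hj]
          field_simp
          ring
      _ ≤ _ := mul_le_mul_of_nonneg_left (h1.trans (hle t ht)) ht.le
  exact hne (le_antisymm (ge_of_tendsto hlim hbound) (mul_nonneg (hc' i j) (hp' i)))

lemma tendsto_regularized_relative_entropy (hs : SupportLE p q c) :
    Tendsto (fun ε : ℝ =>
        ∑ i, ∑ j, c i j * p i * (Real.log (ε * q j + p i) - Real.log (q j + ε * p i)))
      (𝓝[>] 0) (𝓝 (∑ i, ∑ j, c i j * p i * (Real.log (p i) - Real.log (q j)))) := by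
  refine Tendsto.mono_left ?_ nhdsWithin_le_nhds
  refine tendsto_finsetSum _ fun i _ => tendsto_finsetSum _ fun j _ => ?_
  by_cases hcp : c i j * p i = 0
  · simp [hcp]
  · have hqj : q j ≠ 0 := fun h => hcp (hs i j h)
    have hpi : p i ≠ 0 := right_ne_zero_of_mul hcp
    have hcont : ContinuousAt (fun ε : ℝ =>
        c i j * p i * (Real.log (ε * q j + p i) - Real.log (q j + ε * p i))) 0 :=
      continuousAt_const.mul (ContinuousAt.sub
        (ContinuousAt.log (by fun_prop) (by simpa using hpi))
        (ContinuousAt.log (by fun_prop) (by simpa using hqj)))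
    simpa using hcont.tendsto

/-- An inequality between all quasi-entropies implies one between relative entropies, by
integrating over `t` from `ε` to `1/ε` and letting `ε → 0`. -/
lemma relative_entropy_le_of_quasiEntropy_le (hp : ∀ i, 0 ≤ p i) (hq : ∀ j, 0 ≤ q j)
    (hp' : ∀ i, 0 ≤ p' i) (hq' : ∀ j, 0 ≤ q' j)
    (hsum : ∑ i, ∑ j, c i j * p i = 1) (hsum' : ∑ i, ∑ j, c' i j * p' i = 1)
    (hs : SupportLE p q c) (hs' : SupportLE p' q' c')
    (hle : ∀ t, 0 < t → quasiEntropy t p' q' c' ≤ quasiEntropy t p q c) :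
    ∑ i, ∑ j, c' i j * p' i * (Real.log (p' i) - Real.log (q' j)) ≤
      ∑ i, ∑ j, c i j * p i * (Real.log (p i) - Real.log (q j)) := by
  refine le_of_tendsto_of_tendsto (tendsto_regularized_relative_entropy hs')
    (tendsto_regularized_relative_entropy hs) ?_
  filter_upwards [Ioo_mem_nhdsGT (zero_lt_one' ℝ)] with ε hε
  exact regularized_relative_entropy_le hp hq hp' hq' hsum hsum' hle hε.1 hε.2

end Scalar

/-! ### Data processing for the relative entropy -/

section RelativeEntropy

variable {H : Type*} [NormedAddCommGroup H] [InnerProductSpace ℂ H]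
  [FiniteDimensional ℂ H] [CompleteSpace H] {ι : Type*} [Fintype ι] {ρ σ : H →L[ℂ] H}
  {e f : OrthonormalBasis ι ℂ H} {p q : ι → ℝ}

omit [FiniteDimensional ℂ H] [CompleteSpace H] in
lemma sum_overlap (e f : OrthonormalBasis ι ℂ H) (i : ι) : ∑ j, overlap e f i j = 1 := by
  simp only [overlap]
  rw [f.sum_sq_norm_inner_left, e.norm_eq_one, one_pow]

omit [FiniteDimensional ℂ H] [CompleteSpace H] in
lemma sum_overlap_mul_eigenvalue (hρ : tr ρ = 1) (f : OrthonormalBasis ι ℂ H)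
    (he : ∀ i, ρ (e i) = (p i : ℂ) • e i) : ∑ i, ∑ j, overlap e f i j * p i = 1 := by
  simp only [← Finset.sum_mul, sum_overlap, one_mul]
  rw [tr_eq_sum_inner e] at hρ
  have : ((∑ i, p i : ℝ) : ℂ) = 1 := by
    rw [← hρ, Complex.ofReal_sum]
    refine Finset.sum_congr rfl fun i _ => ?_
    simp [he]
  exact_mod_cast this

omit [FiniteDimensional ℂ H] in
lemma inner_apply_self_eq_sum (hρ : IsSelfAdjoint ρ)
    (he : ∀ i, ρ (e i) = (p i : ℂ) • e i) (ψ : H) :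
    ⟪ψ, ρ ψ⟫_ℂ = ((∑ i, p i * ‖⟪e i, ψ⟫_ℂ‖ ^ 2 : ℝ) : ℂ) := by
  rw [← e.sum_inner_mul_inner, Complex.ofReal_sum]
  refine Finset.sum_congr rfl fun i _ => ?_
  rw [inner_apply_eigenvector hρ (he i), mul_left_comm, ← inner_conj_symm ψ (e i),
    RCLike.conj_mul, Complex.ofReal_mul, Complex.ofReal_pow]
  rfl

omit [FiniteDimensional ℂ H] in
lemma supportLE_iff (hρ : IsSelfAdjoint ρ) (hσ : IsSelfAdjoint σ)
    (he : ∀ i, ρ (e i) = (p i : ℂ) • e i)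
    (hf : ∀ j, σ (f j) = (q j : ℂ) • f j) (hp : ∀ i, 0 ≤ p i) :
    SupportLE p q (overlap e f) ↔ ¬ ∃ ψ : H, σ ψ = 0 ∧ ⟪ψ, ρ ψ⟫_ℂ ≠ 0 := by
  constructor
  · rintro hs ⟨ψ, hψ, hne⟩
    refine hne ?_
    rw [inner_apply_self_eq_sum hρ he, Complex.ofReal_eq_zero]
    refine Finset.sum_eq_zero fun i _ => ?_
    by_cases hpi : p i = 0
    · simp [hpi]
    have : ⟪e i, ψ⟫_ℂ = 0 := by
      rw [← f.sum_inner_mul_inner]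
      refine Finset.sum_eq_zero fun j _ => ?_
      by_cases hqj : q j = 0
      · have := (mul_eq_zero.1 (hs i j hqj)).resolve_right hpi
        rw [overlap, sq_eq_zero_iff, norm_eq_zero] at this
        rw [this, zero_mul]
      · have := inner_apply_eigenvector hσ (hf j) ψ
        rw [hψ, inner_zero_right] at this
        rw [(mul_eq_zero.1 this.symm).resolve_left (by exact_mod_cast hqj), mul_zero]
    simp [this]
  · intro h i j hqj
    by_contra hne
    refine h ⟨f j, by simp [hf, hqj], fun h0 => hne ?_⟩
    rw [inner_apply_self_eq_sum hρ he, Complex.ofReal_eq_zero, Finset.sum_eq_zero_iff_of_nonneg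
      (fun i _ => mul_nonneg (hp i) (sq_nonneg _))] at h0
    rw [overlap, mul_comm]
    exact h0 i (Finset.mem_univ i)

lemma traceMulLog_eq_sum (hρ : IsSelfAdjoint ρ) (hσ : IsSelfAdjoint σ)
    (he : ∀ i, ρ (e i) = (p i : ℂ) • e i)
    (hf : ∀ j, σ (f j) = (q j : ℂ) • f j) (hp : ∀ i, 0 ≤ p i)
    (hs : SupportLE p q (overlap e f)) :
    traceMulLog ρ σ = ((∑ i, ∑ j, overlap e f i j * p i * Real.log (q j) : ℝ) : EReal) := by
  rw [traceMulLog, if_neg ((supportLE_iff hρ hσ he hf hp).1 hs), EReal.coe_eq_coe_iff,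
    tr_eq_sum_inner e, Complex.re_sum]
  refine Finset.sum_congr rfl fun i _ => ?_
  have h : ⟪e i, (ρ * CFC.log σ) (e i)⟫_ℂ = p i * ⟪e i, CFC.log σ (e i)⟫_ℂ :=
    inner_apply_eigenvector hρ (he i) _
  rw [h, Complex.re_ofReal_mul, ← f.sum_inner_mul_inner, Complex.re_sum, Finset.mul_sum]
  refine Finset.sum_congr rfl fun j _ => ?_
  rw [CFC.log, inner_cfc_eigenvector hσ _ (hf j), mul_left_comm, Complex.re_ofReal_mul,
    ← inner_conj_symm (f j), RCLike.mul_conj, overlap]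
  norm_cast
  change p i * (Real.log (q j) * ‖⟪e i, f j⟫_ℂ‖ ^ 2) = _
  ring

/-- The second basis `f` is arbitrary: the overlaps in each row sum to one. This form matches
`traceMulLog_eq_sum`. -/
lemma vonNeumannEntropy_eq_sum (hρ : IsSelfAdjoint ρ) (he : ∀ i, ρ (e i) = (p i : ℂ) • e i)
    (f : OrthonormalBasis ι ℂ H) :
    vonNeumannEntropy ρ = -∑ i, ∑ j, overlap e f i j * p i * Real.log (p i) := by
  rw [vonNeumannEntropy, tr_eq_sum_inner e, Complex.re_sum]
  simp only [← Finset.sum_mul, sum_overlap, one_mul]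
  congr 1
  refine Finset.sum_congr rfl fun i _ => ?_
  have h : ⟪e i, (ρ * CFC.log ρ) (e i)⟫_ℂ = p i * ⟪e i, CFC.log ρ (e i)⟫_ℂ :=
    inner_apply_eigenvector hρ (he i) _
  rw [h, Complex.re_ofReal_mul, CFC.log, inner_cfc_eigenvector hρ _ (he i)]
  simp

/-- The data processing inequality `D(Eρ ‖ Eσ) ≤ D(ρ ‖ σ)` for the relative entropy
`D(ρ ‖ σ) = -S(ρ) - tr [ρ ln σ]`, in the case where `D(ρ ‖ σ)` is finite. -/
lemma data_processing {E : (H →L[ℂ] H) →CP (H →L[ℂ] H)}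
    (hE : IsTracePreserving E.toLinearMap) (hρ : IsDensity ρ) (hσ : 0 ≤ σ)
    (hfin : traceMulLog ρ σ ≠ ⊥) :
    ∃ r r' : ℝ, traceMulLog ρ σ = r ∧ traceMulLog (E ρ) (E σ) = r' ∧
      -vonNeumannEntropy (E ρ) - r' ≤ -vonNeumannEntropy ρ - r := by
  have hEρ : 0 ≤ E ρ := map_nonneg E hρ.1
  have hEσ : 0 ≤ E σ := map_nonneg E hσ
  obtain ⟨e, p, hp, he⟩ := exists_eigenbasis hρ.1
  obtain ⟨f, q, hq, hf⟩ := exists_eigenbasis hσ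
  obtain ⟨e', p', hp', he'⟩ := exists_eigenbasis hEρ
  obtain ⟨f', q', hq', hf'⟩ := exists_eigenbasis hEσ
  have aρ := IsSelfAdjoint.of_nonneg hρ.1
  have aσ := IsSelfAdjoint.of_nonneg hσ
  have aEρ := IsSelfAdjoint.of_nonneg hEρ
  have aEσ := IsSelfAdjoint.of_nonneg hEσ
  have hs : SupportLE p q (overlap e f) :=
    (supportLE_iff aρ aσ he hf hp).2 fun h => hfin (if_pos h)
  have hle : ∀ t, 0 < t →
      quasiEntropy t p' q' (overlap e' f') ≤ quasiEntropy t p q (overlap e f) := fun t ht =>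
    quasiEntropy_map_le hE hρ.1 hσ he hf he' hf' hp hq hp' hq' ht
  have hs' : SupportLE p' q' (overlap e' f') :=
    hs.of_quasiEntropy_le hp' hq' (fun _ _ => sq_nonneg _) hle
  have htr : tr (E ρ) = 1 := (hE ρ).trans hρ.2
  refine ⟨_, _, traceMulLog_eq_sum aρ aσ he hf hp hs, traceMulLog_eq_sum aEρ aEσ he' hf' hp' hs',
    ?_⟩
  have h := relative_entropy_le_of_quasiEntropy_le hp hq hp' hq'
    (sum_overlap_mul_eigenvalue hρ.2 f he) (sum_overlap_mul_eigenvalue htr f' he') hs hs' hle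
  rw [vonNeumannEntropy_eq_sum aρ he f, vonNeumannEntropy_eq_sum aEρ he' f', neg_neg, neg_neg]
  simpa only [mul_sub, Finset.sum_sub_distrib] using h

/-- The Hatano–Sasa inequality for a single step. -/
lemma entropy_sub_le_traceMulLog_sub {E : (H →L[ℂ] H) →CP (H →L[ℂ] H)}
    (hE : IsTracePreserving E.toLinearMap) (hρ : IsDensity ρ) (hσ : 0 ≤ σ) (hfix : E σ = σ)
    (hdef : ¬ (traceMulLog (E ρ) σ = ⊥ ∧ traceMulLog ρ σ = ⊥)) :
    ((vonNeumannEntropy ρ - vonNeumannEntropy (E ρ) : ℝ) : EReal) ≤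
      traceMulLog (E ρ) σ - traceMulLog ρ σ := by
  by_cases hbot : traceMulLog ρ σ = ⊥
  · rw [hbot, EReal.sub_bot fun h => hdef ⟨h, hbot⟩]
    exact le_top
  · obtain ⟨r, r', hr, hr', hle⟩ := data_processing hE hρ hσ hbot
    rw [hfix] at hr'
    rw [hr, hr', ← EReal.coe_sub, EReal.coe_le_coe_iff]
    linarith

end RelativeEntropy

lemma ereal_coe_sum {ι : Type*} (s : Finset ι) (f : ι → ℝ) :
    ((∑ i ∈ s, f i : ℝ) : EReal) = ∑ i ∈ s, (f i : EReal) :=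
  map_sum (⟨⟨Real.toEReal, EReal.coe_zero⟩, EReal.coe_add⟩ : ℝ →+ EReal) f s

end HatanoSasa

/-- Quantum Hatano–Sasa inequality. The last hypothesis only says that no difference in the
definition of the excess entropy is of the undefined form `(-∞) - (-∞)`; it holds automatically
when all steady states are positive definite. -/
theorem theorem5p5 {H : Type*} [NormedAddCommGroup H] [InnerProductSpace ℂ H]
    [FiniteDimensional ℂ H] [CompleteSpace H]
    (N : ℕ) (E : ℕ → ((H →L[ℂ] H) →CP (H →L[ℂ] H)))
    (hE : ∀ n ∈ Finset.Icc 1 N, HatanoSasa.IsTracePreserving (E n).toLinearMap)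
    (ρss : ℕ → (H →L[ℂ] H))
    (hss : ∀ n ∈ Finset.Icc 1 N, HatanoSasa.IsUniqueSteadyState (E n).toLinearMap (ρss n))
    (ρ : ℕ → (H →L[ℂ] H)) (hρ0 : HatanoSasa.IsDensity (ρ 0))
    (hρ : ∀ n ∈ Finset.Icc 1 N, ρ n = E n (ρ (n - 1)))
    (hdef : ∀ n ∈ Finset.Icc 1 N,
      ¬ (HatanoSasa.traceMulLog (ρ n) (ρss n) = ⊥ ∧
        HatanoSasa.traceMulLog (ρ (n - 1)) (ρss n) = ⊥)) :
    ((HatanoSasa.vonNeumannEntropy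
          (HatanoSasa.composedMap (fun n => (E n).toLinearMap) N (ρ 0)) -
        HatanoSasa.vonNeumannEntropy (ρ 0) : ℝ) : EReal) ≥
      -HatanoSasa.excessEntropy N ρ ρss := by
  have hcomp : ∀ n ≤ N, HatanoSasa.composedMap (fun n => (E n).toLinearMap) n (ρ 0) = ρ n ∧
      HatanoSasa.IsDensity (ρ n) := by
    intro n
    induction n with
    | zero => exact fun _ => ⟨rfl, hρ0⟩
    | succ n ih =>
      intro hn
      obtain ⟨h1, h2⟩ := ih (by omega)
      have hmem : n + 1 ∈ Finset.Icc 1 N := Finset.mem_Icc.2 ⟨by omega, hn⟩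
      have h3 : ρ (n + 1) = E (n + 1) (ρ n) := hρ (n + 1) hmem
      refine ⟨?_, ?_⟩
      · rw [HatanoSasa.composedMap, LinearMap.comp_apply, h1, h3]
        rfl
      · rw [h3]
        exact ⟨map_nonneg (E (n + 1)) h2.1, (hE (n + 1) hmem (ρ n)).trans h2.2⟩
  have hstep : ∀ n ∈ Finset.Icc 1 N,
      ((HatanoSasa.vonNeumannEntropy (ρ (n - 1)) - HatanoSasa.vonNeumannEntropy (ρ n) : ℝ) :
        EReal) ≤ HatanoSasa.traceMulLog (ρ n) (ρss n) -
          HatanoSasa.traceMulLog (ρ (n - 1)) (ρss n) := by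
    intro n hn
    have hd := hdef n hn
    rw [hρ n hn] at hd ⊢
    exact HatanoSasa.entropy_sub_le_traceMulLog_sub (hE n hn)
      (hcomp (n - 1) ((Nat.sub_le n 1).trans (Finset.mem_Icc.1 hn).2)).2 (hss n hn).1.1
      (hss n hn).2.1 hd
  have htel : ∀ n : ℕ, ∑ k ∈ Finset.Icc 1 n, (HatanoSasa.vonNeumannEntropy (ρ (k - 1)) -
      HatanoSasa.vonNeumannEntropy (ρ k)) =
        HatanoSasa.vonNeumannEntropy (ρ 0) - HatanoSasa.vonNeumannEntropy (ρ n) := by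
    intro n
    induction n with
    | zero => simp
    | succ n ih =>
      rw [Finset.sum_Icc_succ_top (by omega), ih, Nat.add_sub_cancel]
      ring
  have hsum := Finset.sum_le_sum hstep
  rw [← HatanoSasa.ereal_coe_sum, htel N] at hsum
  rw [(hcomp N le_rfl).1, ge_iff_le, EReal.neg_le, ← EReal.coe_neg, neg_sub]
  exact hsum
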